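/- Let $n \in \mathbb{N}$, let $d = \lfloor 0.1n \rfloor$ (so $d = 0.1n$ when $10 \mid n$), and let $\mathbb{F}$ be a field whose characteristic is $0$ or greater than $d$. Let $r \le d$, and let $A_1,\dots,A_r,B_1,\dots,B_r,R \in \mathbb{F}[x_1,\dots,x_n]$ be polynomials such that $A_j(\mathbf{0}) = B_j(\mathbf{0}) = 0$ for every $j$ and $\deg R \le d-1$ (where $\deg 0 = -\infty$). An algebraic formula over $\mathbb{F}$ is a finite rooted tree whose leaves are labelled by variables $x_i$ or by constants from $\mathbb{F}$ and whose inner vertices are sum gates or product gates, of arbitrary finite fan-in; it computes the polynomial at its root. Its formal degree is defined inductively: it is $1$ for a variable, $0$ for a constant, the maximum of the formal degrees of the children for a sum gate, and the sum of the formal degrees of the children for a product gate. Then any algebraic formula over $\mathbb{F}$ of formal degree at most $d$ that computes the polynomial $$\sum_{S \subseteq [n],\ |S| = d}\ \prod_{i \in S} x_i \;+\; \sum_{j=1}^{r} A_j B_j \;+\; R$$ has at least $0.001\,n^2$ vertices. Moreover, if $n \ge 10$, then it has at least $0.001\,n^2$ leaves that are labelled by variables. -/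

import Mathlib

/-- Algebraic formulas over `F` in the variables `σ`: finite rooted trees whose leaves are labelled
by variables or by field constants and whose inner vertices are sum gates or product gates, of
arbitrary finite fan-in (formulas of fan-in two are the special case `k = 2` at every gate). -/
inductive AlgFormula (σ : Type*) (F : Type*) where
  | var (i : σ) : AlgFormula σ F
  | const (c : F) : AlgFormula σ F
  | add {k : ℕ} (child : Fin k → AlgFormula σ F) : AlgFormula σ F
  | mul {k : ℕ} (child : Fin k → AlgFormula σ F) : AlgFormula σ F

namespace AlgFormula

/-- The polynomial computed by a formula (at its root, the output gate). -/
noncomputable def toPoly {σ F : Type*} [CommSemiring F] : AlgFormula σ F → MvPolynomial σ F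
  | var i => MvPolynomial.X i
  | const c => MvPolynomial.C c
  | add child => ∑ j, (child j).toPoly
  | mul child => ∏ j, (child j).toPoly

/-- The formal degree of the root of a formula: `1` for a variable, `0` for a constant, the maximum
of the formal degrees of the children for a sum gate, their sum for a product gate. -/
def formalDegree {σ F : Type*} : AlgFormula σ F → ℕ
  | var _ => 1
  | const _ => 0
  | add child => Finset.univ.sup fun j => (child j).formalDegree
  | mul child => ∑ j, (child j).formalDegree

/-- The number of vertices (leaves and gates) of a formula. -/
def numVertices {σ F : Type*} : AlgFormula σ F → ℕ
  | var _ => 1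
  | const _ => 1
  | add child => 1 + ∑ j, (child j).numVertices
  | mul child => 1 + ∑ j, (child j).numVertices

/-- The number of leaves of a formula that are labelled by variables. -/
def numVarLeaves {σ F : Type*} : AlgFormula σ F → ℕ
  | var _ => 1
  | const _ => 0
  | add child => ∑ j, (child j).numVarLeaves
  | mul child => ∑ j, (child j).numVarLeaves

end AlgFormula

/-! Fix `d` and call the rank of a polynomial the least number of products of two polynomials
vanishing at the origin whose sum it is, up to a polynomial of degree at most `d`.

The elementary symmetric polynomial `e_{d+1}` in `n` variables has large rank. Suppose that
`e_{d+1} = ∑ A_j B_j + R` with `t` products, over a field, and let `I` be the ideal generated by the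
`A_j`, the `B_j` and `e_1, …, e_d`. As `∂ᵢ e_{k+1} = e_k - xᵢ ∂ᵢ e_k`, differentiation gives
`(-xᵢ) ^ d ≡ ∂ᵢ R` modulo `I`, with `deg ∂ᵢ R < d`, so the quotient by `I` is finite-dimensional.
But `I` is contained in the maximal ideal of the origin, of height `n`, and has `2 t + d`
generators, so `n ≤ 2 t + d` by Krull's height theorem. Over a commutative ring, pass to a residue
field.

A formula of formal degree at most `d + 1` with `w` variable leaves computes a polynomial of rank at
most `w / m` if `2 m ≤ d + 1`: going up the formula, one carries along a remainder of degree less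
than `m`. Once the product of two remainders has degree in `[m, 2 m)`, it becomes a factor of a
split-off product, at the expense of `m` variable leaves.
-/

open MvPolynomial

section ElementarySymmetric

variable {σ R : Type*}

lemma esymm_cons_succ [CommSemiring R] (a : R) (s : Multiset R) (k : ℕ) :
    (a ::ₘ s).esymm (k + 1) = s.esymm (k + 1) + a * s.esymm k := by
  simp [Multiset.esymm, Multiset.map_map, Multiset.sum_map_mul_left]

lemma derivation_esymm_eq_zero {A : Type*} [CommSemiring R] [CommSemiring A] [Algebra R A]
    (D : Derivation R A A) {s : Multiset A} (hs : ∀ a ∈ s, D a = 0) (k : ℕ) :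
    D (s.esymm k) = 0 := by
  induction s using Multiset.induction generalizing k with
  | empty => cases k <;> simp [Multiset.esymm, Multiset.powersetCard_zero_right]
  | cons a s ih =>
    rw [Multiset.forall_mem_cons] at hs
    cases k with
    | zero => simp [Multiset.esymm]
    | succ k => simp [esymm_cons_succ, Derivation.leibniz, hs.1, ih hs.2]

lemma pderiv_esymm_succ_add [CommSemiring R] [Fintype σ] (i : σ) (k : ℕ) :
    pderiv i (esymm σ R (k + 1)) + X i * pderiv i (esymm σ R k) = esymm σ R k := by
  classical
  set s : Multiset (MvPolynomial σ R) := (Finset.univ.erase i).val.map X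
  have hs : ∀ k, pderiv i (s.esymm k) = 0 := by
    refine derivation_esymm_eq_zero _ fun p hp => ?_
    obtain ⟨j, hj, rfl⟩ := Multiset.mem_map.1 hp
    exact pderiv_X_of_ne (Finset.ne_of_mem_erase hj)
  have hcons : Finset.univ.val.map X = X i ::ₘ s := by
    rw [← Multiset.map_cons, ← Finset.insert_val_of_notMem (Finset.notMem_erase i _),
      Finset.insert_erase (Finset.mem_univ i)]
  have hzero (s : Multiset (MvPolynomial σ R)) : s.esymm 0 = 1 := by simp [Multiset.esymm]
  rw [esymm_eq_multiset_esymm, hcons]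
  cases k with
  | zero => simp [esymm_cons_succ, hs, hzero]
  | succ k => simp [esymm_cons_succ, hs]

lemma pderiv_esymm_succ_sub_mem [CommRing R] [Fintype σ] {I : Ideal (MvPolynomial σ R)} {k : ℕ}
    (hI : ∀ j < k, esymm σ R (j + 1) ∈ I) (i : σ) :
    pderiv i (esymm σ R (k + 1)) - (-X i) ^ k ∈ I := by
  induction k with
  | zero =>
    have h := pderiv_esymm_succ_add (R := R) i 0
    simp only [esymm_zero, pderiv_one, mul_zero, add_zero] at h
    rw [h]
    simp
  | succ k ih =>
    have hk := I.mul_mem_left (X i) (ih fun j hj => hI j (hj.trans k.lt_succ_self))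
    convert I.sub_mem (hI k k.lt_succ_self) hk using 1
    linear_combination pderiv_esymm_succ_add (R := R) i (k + 1)

lemma constantCoeff_esymm_succ [CommSemiring R] [Fintype σ] (k : ℕ) :
    constantCoeff (esymm σ R (k + 1)) = 0 := by
  rw [esymm, map_sum]
  refine Finset.sum_eq_zero fun t ht => ?_
  obtain ⟨j, hj⟩ : t.Nonempty := Finset.card_pos.1 (by simp [(Finset.mem_powersetCard.1 ht).2])
  rw [map_prod]
  exact Finset.prod_eq_zero hj (constantCoeff_X _ j)

end ElementarySymmetric

section FiniteQuotient

variable {σ R : Type*}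

lemma degree_lt_of_mem_support_pderiv [CommSemiring R] {p : MvPolynomial σ R} {d : ℕ}
    (hp : p.totalDegree ≤ d) {i : σ} {m : σ →₀ ℕ} (hm : m ∈ (pderiv i p).support) :
    m.degree < d := by
  rw [mem_support_iff, coeff_pderiv] at hm
  have h : (m + Finsupp.single i 1).degree ≤ p.totalDegree :=
    le_totalDegree (mem_support_iff.2 (left_ne_zero_of_mul hm))
  rw [map_add, Finsupp.degree_single] at h
  omega

variable [CommRing R]

open MonomialOrder in
lemma degLex_degree_eq_and_monic_X_pow_sub [LinearOrder σ] [WellFoundedGT σ] [Nontrivial R]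
    {N : ℕ} (i : σ) {p : MvPolynomial σ R} (hp : ∀ m ∈ p.support, m.degree < N) :
    degLex.degree (X i ^ N - p) = Finsupp.single i N ∧ degLex.Monic (X i ^ N - p) := by
  classical
  have hX : degLex.degree (X i ^ N : MvPolynomial σ R) = Finsupp.single i N := by
    rw [X_pow_eq_monomial, degree_monomial, if_neg one_ne_zero]
  have hmonic : degLex.Monic (X i ^ N : MvPolynomial σ R) := degLex.monic_X.pow
  rcases eq_or_ne p 0 with rfl | h0
  · rw [sub_zero]
    exact ⟨hX, hmonic⟩
  have hlt : degLex.degree p ≺[degLex] degLex.degree (X i ^ N : MvPolynomial σ R) := by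
    rw [hX, degLex_lt_iff, Finsupp.DegLex.lt_iff]
    left
    simpa using hp _ (degLex.degree_mem_support h0)
  exact ⟨(degree_sub_of_lt hlt).trans hX, (leadingCoeff_sub_of_lt hlt).trans hmonic⟩

/-- Division with respect to the degree-lexicographic order leaves remainders of degree at most
`N` in each variable. -/
lemma finite_quotient_of_X_pow_sub_mem [Finite σ] {I : Ideal (MvPolynomial σ R)} {N : ℕ}
    {p : σ → MvPolynomial σ R} (hp : ∀ i, ∀ m ∈ (p i).support, m.degree < N)
    (hI : ∀ i, X i ^ N - p i ∈ I) : Module.Finite R (MvPolynomial σ R ⧸ I) := by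
  cases subsingleton_or_nontrivial R
  · have := Module.subsingleton R (MvPolynomial σ R ⧸ I)
    infer_instance
  obtain ⟨_, _⟩ := exists_wellFoundedLT σ
  refine Module.Finite.of_surjective
    ((Ideal.Quotient.mkₐ R I).toLinearMap ∘ₗ (restrictDegree σ R N).subtype) fun q => ?_
  obtain ⟨f, rfl⟩ := Ideal.Quotient.mk_surjective q
  obtain ⟨g, r, hf, -, hr⟩ := MonomialOrder.degLex.div
    (fun i => (degLex_degree_eq_and_monic_X_pow_sub i (hp i)).2.leadingCoeff_eq_one ▸ isUnit_one) f
  refine ⟨⟨r, ?_⟩, Ideal.Quotient.eq.2 ?_⟩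
  · rw [mem_restrictDegree]
    intro m hm i
    have := hr m hm i
    rw [(degLex_degree_eq_and_monic_X_pow_sub i (hp i)).1, Finsupp.single_le_iff] at this
    omega
  · rw [Submodule.subtype_apply, hf, ← neg_mem_iff, neg_sub, add_sub_cancel_right,
      Finsupp.linearCombination_apply]
    exact I.sum_mem fun i _ => I.mul_mem_left _ (hI i)

end FiniteQuotient

section Height

variable {σ R : Type*}

section CommSemiring

variable [CommSemiring R]

/-- The substitution of zero for the variables in `s`. -/
noncomputable def substZero (R : Type*) [CommSemiring R] (s : Set σ) :
    MvPolynomial σ R →ₐ[R] MvPolynomial σ R :=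
  aeval (sᶜ.indicator X)

lemma substZero_X_of_mem {s : Set σ} {i : σ} (hi : i ∈ s) : substZero R s (X i) = 0 := by
  simp [substZero, hi]

lemma substZero_X_of_notMem {s : Set σ} {i : σ} (hi : i ∉ s) : substZero R s (X i) = X i := by
  simp [substZero, hi]

lemma substZero_comp {s t : Set σ} (hst : s ⊆ t) :
    (substZero R t).comp (substZero R s) = substZero R t := by
  ext1 i
  by_cases hi : i ∈ s
  · simp [substZero_X_of_mem hi, substZero_X_of_mem (hst hi)]
  · simp [substZero_X_of_notMem hi]

lemma ker_substZero_univ :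
    RingHom.ker (substZero R (Set.univ : Set σ)) =
      RingHom.ker (constantCoeff : MvPolynomial σ R →+* R) := by
  ext p
  rw [RingHom.mem_ker, RingHom.mem_ker, substZero, Set.compl_univ, Set.indicator_empty', aeval_zero,
    MvPolynomial.algebraMap_eq, C_eq_zero]

lemma ker_substZero_lt_insert [Nontrivial R] {s : Set σ} {i : σ} (hi : i ∉ s) :
    RingHom.ker (substZero R s) < RingHom.ker (substZero R (insert i s)) := by
  refine SetLike.lt_iff_le_and_exists.2 ⟨fun p hp => ?_, X i, ?_, ?_⟩
  · rw [RingHom.mem_ker] at hp ⊢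
    rw [← substZero_comp (Set.subset_insert i s), AlgHom.comp_apply, hp, map_zero]
  · exact substZero_X_of_mem (Set.mem_insert i s)
  · rw [RingHom.mem_ker, substZero_X_of_notMem hi]
    exact X_ne_zero i

end CommSemiring

lemma card_le_height_ker_substZero [CommRing R] [IsDomain R] (s : Finset σ) :
    (s.card : ℕ∞) ≤ (RingHom.ker (substZero R (s : Set σ))).height := by
  classical
  induction s using Finset.induction_on with
  | empty => simp
  | insert i s hi ih =>
    have (t : Set σ) : (RingHom.ker (substZero R t)).IsPrime := RingHom.ker_isPrime _
    rw [Finset.card_insert_of_notMem hi, Finset.coe_insert, Nat.cast_add_one]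
    exact (add_le_add_left ih 1).trans
      (Ideal.height_add_one_le_of_lt_of_isPrime (ker_substZero_lt_insert (by simpa using hi)))

lemma card_le_height_ker_constantCoeff [CommRing R] [IsDomain R] [Fintype σ] :
    (Fintype.card σ : ℕ∞) ≤ (RingHom.ker (constantCoeff : MvPolynomial σ R →+* R)).height := by
  simpa [ker_substZero_univ] using card_le_height_ker_substZero (R := R) (Finset.univ : Finset σ)

lemma card_le_card_of_finite_quotient_span {F ι : Type*} [Field F] [Fintype σ] [Fintype ι]
    {p : ι → MvPolynomial σ F} (hp : ∀ j, constantCoeff (p j) = 0)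
    [Module.Finite F (MvPolynomial σ F ⧸ Ideal.span (Set.range p))] :
    Fintype.card σ ≤ Fintype.card ι := by
  have : (RingHom.ker (constantCoeff : MvPolynomial σ F →+* F)).IsPrime := RingHom.ker_isPrime _
  have : IsArtinianRing (MvPolynomial σ F ⧸ Ideal.span (Set.range p)) := .of_finite F _
  have hdim : ringKrullDim (MvPolynomial σ F ⧸ Ideal.span (Set.range p)) ≤ 0 :=
    Ring.krullDimLE_iff.1 inferInstance
  have hcard : (Set.range p).encard ≤ Fintype.card ι := by
    simpa using Set.encard_image_le p Set.univ
  have hheight : (RingHom.ker (constantCoeff : MvPolynomial σ F →+* F)).height ≤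
      ringKrullDim (MvPolynomial σ F ⧸ Ideal.span (Set.range p)) + (Set.range p).encard :=
    Ideal.height_le_ringKrullDim_quotient_add_encard _ (Set.range_subset_iff.2 hp)
  have hle : (RingHom.ker (constantCoeff : MvPolynomial σ F →+* F)).height ≤ Fintype.card ι := by
    have := hheight.trans (add_le_add hdim (WithBot.coe_le_coe.2 hcard))
    rw [zero_add] at this
    exact_mod_cast this
  exact_mod_cast card_le_height_ker_constantCoeff.trans hle

end Height

section ProductRank

variable {σ K : Type*}

/-- Up to a polynomial of degree at most `d`, the polynomial `p` is a sum of `t` products of two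
polynomials without constant term. -/
def HasProductRankLE [CommSemiring K] (d t : ℕ) (p : MvPolynomial σ K) : Prop :=
  ∃ (A B : Fin t → MvPolynomial σ K) (R : MvPolynomial σ K),
    (∀ j, constantCoeff (A j) = 0) ∧ (∀ j, constantCoeff (B j) = 0) ∧ R.totalDegree ≤ d ∧
      p = ∑ j, A j * B j + R

namespace HasProductRankLE

section CommSemiring

variable [CommSemiring K] {d t u : ℕ} {p q : MvPolynomial σ K}

lemma of_totalDegree_le (hp : p.totalDegree ≤ d) : HasProductRankLE d 0 p :=
  ⟨0, 0, p, fun j => j.elim0, fun j => j.elim0, hp, by simp⟩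

lemma add (hp : HasProductRankLE d t p) (hq : HasProductRankLE d u q) :
    HasProductRankLE d (t + u) (p + q) := by
  obtain ⟨A, B, R, hA, hB, hR, rfl⟩ := hp
  obtain ⟨A', B', R', hA', hB', hR', rfl⟩ := hq
  refine ⟨Fin.append A A', Fin.append B B', R + R', ?_, ?_,
    (totalDegree_add _ _).trans (max_le hR hR'), ?_⟩
  · exact Fin.addCases (by simpa using hA) (by simpa using hA')
  · exact Fin.addCases (by simpa using hB) (by simpa using hB')
  · simp only [Fin.sum_univ_add, Fin.append_left, Fin.append_right]
    ring

lemma multiset_sum {s : Multiset (MvPolynomial σ K)} (hs : ∀ p ∈ s, HasProductRankLE d 1 p) :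
    HasProductRankLE d s.card s.sum := by
  induction s using Multiset.induction with
  | empty => exact of_totalDegree_le (by simp)
  | cons p s ih =>
    rw [Multiset.forall_mem_cons] at hs
    rw [Multiset.card_cons, Multiset.sum_cons, add_comm s.card]
    exact hs.1.add (ih hs.2)

lemma map {L : Type*} [CommSemiring L] (f : K →+* L) (hp : HasProductRankLE d t p) :
    HasProductRankLE d t (MvPolynomial.map f p) := by
  obtain ⟨A, B, R, hA, hB, hR, rfl⟩ := hp
  refine ⟨fun j => MvPolynomial.map f (A j), fun j => MvPolynomial.map f (B j),
    MvPolynomial.map f R, by simp [constantCoeff_map, hA], by simp [constantCoeff_map, hB], ?_,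
    by simp⟩
  exact (Finset.sup_mono (support_map_subset f R)).trans hR

end CommSemiring

variable [CommRing K] {d t : ℕ} {p : MvPolynomial σ K}

lemma neg (hp : HasProductRankLE d t p) : HasProductRankLE d t (-p) := by
  obtain ⟨A, B, R, hA, hB, hR, rfl⟩ := hp
  refine ⟨-A, B, -R, by simpa using hA, hB, by rwa [totalDegree_neg], ?_⟩
  simp [Finset.sum_neg_distrib, add_comm]

lemma sub {u : ℕ} {q : MvPolynomial σ K} (hp : HasProductRankLE d t p)
    (hq : HasProductRankLE d u q) : HasProductRankLE d (t + u) (p - q) :=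
  sub_eq_add_neg p q ▸ hp.add hq.neg

lemma mul_of_totalDegree_le {P Q : MvPolynomial σ K} (hP : P.totalDegree ≤ d)
    (hQ : Q.totalDegree ≤ d) : HasProductRankLE d 1 (P * Q) := by
  set a := constantCoeff P
  set b := constantCoeff Q
  refine ⟨fun _ => P - C a, fun _ => Q - C b, a • Q + b • (P - C a), by simp [a], by simp [b],
    (totalDegree_add _ _).trans (max_le ?_ ?_), ?_⟩
  · exact (totalDegree_smul_le _ _).trans hQ
  · exact (totalDegree_smul_le _ _).trans ((totalDegree_sub_C_le _ _).trans hP)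
  · simp only [Finset.univ_unique, Finset.sum_const, Finset.card_singleton, one_smul, smul_eq_C_mul]
    ring

lemma card_le_of_esymm_of_field {F : Type*} [Field F] [Fintype σ]
    (h : HasProductRankLE d t (esymm σ F (d + 1))) : Fintype.card σ ≤ 2 * t + d := by
  obtain ⟨A, B, R, hA, hB, hR, h⟩ := h
  let p : Fin t ⊕ Fin t ⊕ Fin d → MvPolynomial σ F :=
    Sum.elim A (Sum.elim B fun j => esymm σ F (j + 1))
  let I := Ideal.span (Set.range p)
  have hpI (j) : p j ∈ I := Ideal.subset_span (Set.mem_range_self j)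
  have hAB (i : σ) : pderiv i (∑ j, A j * B j) ∈ I := by
    rw [map_sum]
    refine I.sum_mem fun j _ => ?_
    rw [pderiv_mul]
    exact I.add_mem (I.mul_mem_left _ (hpI (.inr (.inl j)))) (I.mul_mem_right _ (hpI (.inl j)))
  have hXR (i : σ) : (-X i) ^ d - pderiv i R ∈ I := by
    have hesymm := pderiv_esymm_succ_sub_mem (I := I) (k := d)
      (fun j hj => hpI (.inr (.inr ⟨j, hj⟩))) i
    rw [h, map_add] at hesymm
    convert I.sub_mem (hAB i) hesymm using 1
    ring
  have : Module.Finite F (MvPolynomial σ F ⧸ I) := by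
    refine finite_quotient_of_X_pow_sub_mem (N := d) (p := fun i => pderiv i ((-1 : F) ^ d • R))
      (fun i m => degree_lt_of_mem_support_pderiv ((totalDegree_smul_le _ _).trans hR)) fun i => ?_
    convert I.mul_mem_left ((-1) ^ d) (hXR i) using 1
    rw [Derivation.map_smul, mul_sub, ← mul_pow, neg_one_mul, neg_neg, smul_eq_C_mul, C_pow, C_neg,
      C_1]
  have hp : ∀ j, constantCoeff (p j) = 0 := by
    rintro (j | j | j)
    exacts [hA j, hB j, constantCoeff_esymm_succ _]
  have := card_le_card_of_finite_quotient_span hp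
  simp only [Fintype.card_sum, Fintype.card_fin] at this
  omega

theorem card_le_of_esymm [Nontrivial K] [Fintype σ]
    (h : HasProductRankLE d t (esymm σ K (d + 1))) : Fintype.card σ ≤ 2 * t + d := by
  obtain ⟨M, _⟩ := Ideal.exists_maximal K
  let := Ideal.Quotient.field M
  exact card_le_of_esymm_of_field (map_esymm σ K _ (Ideal.Quotient.mk M) ▸ h.map _)

end HasProductRankLE

end ProductRank

section BalancedSplitting

variable {σ K : Type*} [CommSemiring K] {m D D' w w' : ℕ} {p q : MvPolynomial σ K}

/-- `p` is a product of polynomials of degree less than `2 * m` and at most `D - m`, as it arises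
when a factor with degree in `[m, 2 * m)` is split off from a product of degree at most `D`. The
form `deg Q + m ≤ D` of the second bound includes `m ≤ D`. -/
def IsBalancedProduct (m D : ℕ) (p : MvPolynomial σ K) : Prop :=
  ∃ P Q : MvPolynomial σ K, P.totalDegree < 2 * m ∧ Q.totalDegree + m ≤ D ∧ p = P * Q

lemma IsBalancedProduct.mono (hp : IsBalancedProduct m D p) (hD : D ≤ D') :
    IsBalancedProduct m D' p := by
  obtain ⟨P, Q, hP, hQ, rfl⟩ := hp
  exact ⟨P, Q, hP, hQ.trans hD, rfl⟩

lemma IsBalancedProduct.mul_right (hp : IsBalancedProduct m D p) (hq : q.totalDegree ≤ D') :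
    IsBalancedProduct m (D + D') (p * q) := by
  obtain ⟨P, Q, hP, hQ, rfl⟩ := hp
  refine ⟨P, Q * q, hP, ?_, mul_assoc P Q q⟩
  have := totalDegree_mul Q q
  omega

/-- A polynomial `p` of degree at most `D` is a sum of balanced products and a remainder of degree
less than `m`, where each product has cost `m` and the cost of the remainder is its degree; the
total cost is at most `w`. -/
def HasBalancedSplitting (m D w : ℕ) (p : MvPolynomial σ K) : Prop :=
  p.totalDegree ≤ D ∧ ∃ (s : Multiset (MvPolynomial σ K)) (S : MvPolynomial σ K),
    (∀ q ∈ s, IsBalancedProduct m D q) ∧ S.totalDegree < m ∧ S.totalDegree ≤ D ∧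
      s.card * m + S.totalDegree ≤ w ∧ p = s.sum + S

namespace HasBalancedSplitting

lemma mono (hp : HasBalancedSplitting m D w p) (hD : D ≤ D') (hw : w ≤ w') :
    HasBalancedSplitting m D' w' p := by
  obtain ⟨hpD, s, S, hs, hSm, hSD, hsw, rfl⟩ := hp
  exact ⟨hpD.trans hD, s, S, fun q hq => (hs q hq).mono hD, hSm, hSD.trans hD, hsw.trans hw, rfl⟩

lemma of_totalDegree_lt_two_mul (hp : p.totalDegree < 2 * m) :
    HasBalancedSplitting m p.totalDegree p.totalDegree p := by
  refine ⟨le_rfl, ?_⟩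
  rcases lt_or_ge p.totalDegree m with h | h
  · exact ⟨0, p, by simp, h, le_rfl, by simp, by simp⟩
  · refine ⟨{p}, 0, ?_, by simp; omega, by simp, by simpa using h, by simp⟩
    intro q hq
    exact ⟨p, 1, hp, by simpa using h, by rw [Multiset.mem_singleton.1 hq, mul_one]⟩

lemma add (hp : HasBalancedSplitting m D w p) (hq : HasBalancedSplitting m D w' q) :
    HasBalancedSplitting m D (w + w') (p + q) := by
  obtain ⟨hpD, s, S, hs, hSm, hSD, hsw, rfl⟩ := hp
  obtain ⟨hqD, s', S', hs', hSm', hSD', hsw', rfl⟩ := hq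
  have hSS' := totalDegree_add S S'
  refine ⟨(totalDegree_add _ _).trans (max_le hpD hqD), s + s', S + S', ?_, by omega, by omega, ?_,
    ?_⟩
  · exact fun q hq => (Multiset.mem_add.1 hq).elim (hs q) (hs' q)
  · rw [Multiset.card_add, add_mul]
    omega
  · rw [Multiset.sum_add]
    abel

lemma mul (hp : HasBalancedSplitting m D w p) (hq : HasBalancedSplitting m D' w' q) :
    HasBalancedSplitting m (D + D') (w + w') (p * q) := by
  obtain ⟨hpD, s, S, hs, hSm, hSD, hsw, rfl⟩ := hp
  obtain ⟨hqD, s', S', hs', hSm', hSD', hsw', rfl⟩ := hq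
  have hSS' := totalDegree_mul S S'
  obtain ⟨-, t, U, ht, hUm, hUD, hUt, hU⟩ := of_totalDegree_lt_two_mul (p := S * S') (m := m)
    (by omega)
  refine ⟨(totalDegree_mul _ _).trans (add_le_add hpD hqD),
    s.map (· * (s'.sum + S')) + s'.map (· * S) + t, U, ?_, hUm, by omega, ?_, ?_⟩
  · simp only [Multiset.mem_add, Multiset.mem_map]
    rintro _ ((⟨x, hx, rfl⟩ | ⟨x, hx, rfl⟩) | hx)
    · exact (hs x hx).mul_right hqD
    · exact add_comm D D' ▸ (hs' x hx).mul_right hSD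
    · exact (ht _ hx).mono (by omega)
  · simp only [Multiset.card_add, Multiset.card_map, add_mul]
    omega
  · rw [Multiset.sum_add, Multiset.sum_add, Multiset.sum_map_mul_right, Multiset.sum_map_mul_right,
      Multiset.map_id', Multiset.map_id', add_assoc, ← hU]
    ring

lemma finset_sum {ι : Type*} {s : Finset ι} {w : ι → ℕ} {p : ι → MvPolynomial σ K} (hm : 0 < m)
    (hp : ∀ j ∈ s, HasBalancedSplitting m D (w j) (p j)) :
    HasBalancedSplitting m D (∑ j ∈ s, w j) (∑ j ∈ s, p j) := by
  classical
  induction s using Finset.induction_on with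
  | empty => exact (of_totalDegree_lt_two_mul (p := 0) (by simpa)).mono (by simp) (by simp)
  | insert i s hi ih =>
    rw [Finset.forall_mem_insert] at hp
    rw [Finset.sum_insert hi, Finset.sum_insert hi]
    exact hp.1.add (ih hp.2)

lemma finset_prod {ι : Type*} {s : Finset ι} {D w : ι → ℕ} {p : ι → MvPolynomial σ K} (hm : 0 < m)
    (hp : ∀ j ∈ s, HasBalancedSplitting m (D j) (w j) (p j)) :
    HasBalancedSplitting m (∑ j ∈ s, D j) (∑ j ∈ s, w j) (∏ j ∈ s, p j) := by
  classical
  induction s using Finset.induction_on with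
  | empty => exact (of_totalDegree_lt_two_mul (p := 1) (by simpa)).mono (by simp) (by simp)
  | insert i s hi ih =>
    rw [Finset.forall_mem_insert] at hp
    rw [Finset.sum_insert hi, Finset.sum_insert hi, Finset.prod_insert hi]
    exact hp.1.mul (ih hp.2)

lemma exists_hasProductRankLE {K : Type*} [CommRing K] {d : ℕ} {p : MvPolynomial σ K}
    (hp : HasBalancedSplitting m D w p) (hD : D ≤ d + 1) (hm : 2 * m ≤ d + 1) :
    ∃ t, t * m ≤ w ∧ HasProductRankLE d t p := by
  obtain ⟨-, s, S, hs, hSm, -, hsw, rfl⟩ := hp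
  have hrank : ∀ q ∈ s, HasProductRankLE d 1 q := by
    intro q hq
    obtain ⟨P, Q, hP, hQ, rfl⟩ := hs q hq
    exact .mul_of_totalDegree_le (by omega) (by omega)
  exact ⟨s.card, by omega, (HasProductRankLE.multiset_sum hrank).add
    (.of_totalDegree_le (by omega))⟩

end HasBalancedSplitting

end BalancedSplitting

namespace AlgFormula

section

variable {σ F : Type*}

lemma formalDegree_le_numVarLeaves (Φ : AlgFormula σ F) : Φ.formalDegree ≤ Φ.numVarLeaves := by
  induction Φ with
  | var i => exact le_rfl
  | const c => exact le_rfl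
  | add child ih =>
    exact Finset.sup_le fun j hj =>
      (ih j).trans (Finset.single_le_sum (f := fun j => (child j).numVarLeaves)
        (fun _ _ => Nat.zero_le _) hj)
  | mul child ih => exact Finset.sum_le_sum fun j _ => ih j

lemma numVarLeaves_le_numVertices (Φ : AlgFormula σ F) : Φ.numVarLeaves ≤ Φ.numVertices := by
  induction Φ with
  | var i => exact le_rfl
  | const _ => exact Nat.zero_le 1
  | add child ih | mul child ih =>
    exact (Finset.sum_le_sum fun j _ => ih j).trans (Nat.le_add_left _ _)

lemma numVertices_pos (Φ : AlgFormula σ F) : 0 < Φ.numVertices := by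
  cases Φ <;> simp [numVertices]

lemma hasBalancedSplitting [CommSemiring F] {m : ℕ} (hm : 0 < m) (Φ : AlgFormula σ F) :
    HasBalancedSplitting m Φ.formalDegree Φ.numVarLeaves Φ.toPoly := by
  induction Φ with
  | var i =>
    have hX : (X i : MvPolynomial σ F).totalDegree ≤ 1 :=
      (totalDegree_monomial_le _ _).trans (by simp)
    have hm' : (X i : MvPolynomial σ F).totalDegree < 2 * m := by omega
    exact (HasBalancedSplitting.of_totalDegree_lt_two_mul hm').mono hX hX
  | const c =>
    have hC := totalDegree_C (σ := σ) c
    have hm' : (C c : MvPolynomial σ F).totalDegree < 2 * m := by omega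
    exact (HasBalancedSplitting.of_totalDegree_lt_two_mul hm').mono hC.le hC.le
  | add child ih =>
    exact .finset_sum hm fun j hj =>
      (ih j).mono (Finset.le_sup (f := fun j => (child j).formalDegree) hj) le_rfl
  | mul child ih => exact .finset_prod hm fun j _ => ih j

lemma totalDegree_toPoly_le [CommSemiring F] (Φ : AlgFormula σ F) :
    Φ.toPoly.totalDegree ≤ Φ.formalDegree :=
  (Φ.hasBalancedSplitting one_pos).1

end

section LowerBound

variable {σ K : Type*} [CommRing K] [Nontrivial K] [Fintype σ] {d r : ℕ} {q : MvPolynomial σ K}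

lemma lt_formalDegree_of_toPoly_eq (Φ : AlgFormula σ K) (hq : HasProductRankLE d r q)
    (hΦ : Φ.toPoly = esymm σ K (d + 1) + q) (hr : 2 * r + d < Fintype.card σ) :
    d < Φ.formalDegree := by
  by_contra! hdeg
  have hrank : HasProductRankLE d (0 + r) (esymm σ K (d + 1)) :=
    eq_sub_of_add_eq hΦ.symm ▸
      (HasProductRankLE.of_totalDegree_le (Φ.totalDegree_toPoly_le.trans hdeg)).sub hq
  have := hrank.card_le_of_esymm
  omega

theorem card_sub_mul_le_numVarLeaves (Φ : AlgFormula σ K) (hq : HasProductRankLE d r q)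
    (hΦ : Φ.toPoly = esymm σ K (d + 1) + q) (hdeg : Φ.formalDegree ≤ d + 1) {m : ℕ}
    (hm : 2 * m ≤ d + 1) :
    (Fintype.card σ - (2 * r + d)) * m ≤ 2 * Φ.numVarLeaves := by
  rcases m.eq_zero_or_pos with rfl | hm0
  · exact Nat.zero_le _
  obtain ⟨t, ht, hrank⟩ := (Φ.hasBalancedSplitting hm0).exists_hasProductRankLE hdeg hm
  have hesymm : HasProductRankLE d (t + r) (esymm σ K (d + 1)) :=
    eq_sub_of_add_eq hΦ.symm ▸ hrank.sub hq
  have hcard := hesymm.card_le_of_esymm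
  calc (Fintype.card σ - (2 * r + d)) * m ≤ 2 * t * m := by gcongr; omega
    _ ≤ 2 * Φ.numVarLeaves := by rw [mul_assoc]; gcongr

lemma sq_card_le_mul_numVarLeaves (Φ : AlgFormula σ K) (hq : HasProductRankLE d r q)
    (hΦ : Φ.toPoly = esymm σ K (d + 1) + q) (hdeg : Φ.formalDegree ≤ d + 1)
    (hd : Fintype.card σ / 10 = d + 1) (hr : r ≤ d + 1) :
    Fintype.card σ ^ 2 ≤ 1000 * Φ.numVarLeaves := by
  rcases d.eq_zero_or_pos with rfl | hd0
  · have h1 := Φ.lt_formalDegree_of_toPoly_eq hq hΦ (by omega)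
    have h2 := Φ.formalDegree_le_numVarLeaves
    have h3 : Fintype.card σ ≤ 19 := by omega
    nlinarith
  · have hbound := Φ.card_sub_mul_le_numVarLeaves hq hΦ hdeg (Nat.mul_div_le (d + 1) 2)
    have h1 : 7 * Fintype.card σ ≤ 10 * (Fintype.card σ - (2 * r + d)) := by omega
    have h2 : Fintype.card σ ≤ 40 * ((d + 1) / 2) := by omega
    have h3 := Nat.mul_le_mul h1 h2
    nlinarith

end LowerBound

end AlgFormula

theorem theorem5p9_general (n : ℕ) (K : Type*) [CommRing K] [Nontrivial K]
    (r : ℕ) (hr : r ≤ n / 10)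
    (A B : Fin r → MvPolynomial (Fin n) K) (R : MvPolynomial (Fin n) K)
    (hA : ∀ j, eval 0 (A j) = 0) (hB : ∀ j, eval 0 (B j) = 0)
    (hR : R = 0 ∨ R.totalDegree + 1 ≤ n / 10)
    (Φ : AlgFormula (Fin n) K) (hdeg : Φ.formalDegree ≤ n / 10)
    (hΦ : Φ.toPoly = esymm (Fin n) K (n / 10) + ∑ j, A j * B j + R) :
    (0.001 : ℝ) * (n : ℝ) ^ 2 ≤ (Φ.numVertices : ℝ) ∧
      (10 ≤ n → (0.001 : ℝ) * (n : ℝ) ^ 2 ≤ (Φ.numVarLeaves : ℝ)) := by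
  have hleaves (hn : 10 ≤ n) : n ^ 2 ≤ 1000 * Φ.numVarLeaves := by
    obtain ⟨d, hd⟩ : ∃ d, n / 10 = d + 1 := Nat.exists_eq_succ_of_ne_zero (by omega)
    rw [hd] at hr hR hdeg hΦ
    have hR' : R.totalDegree ≤ d := hR.elim (fun h => by simp [h]) Nat.le_of_succ_le_succ
    rw [eval_zero] at hA hB
    have hrank : HasProductRankLE d r (∑ j, A j * B j + R) := ⟨A, B, R, hA, hB, hR', rfl⟩
    simpa using Φ.sq_card_le_mul_numVarLeaves hrank (hΦ.trans (add_assoc _ _ _)) hdeg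
      (by simpa using hd) hr
  have hvertices : n ^ 2 ≤ 1000 * Φ.numVertices := by
    rcases le_or_gt 10 n with hn | hn
    · exact (hleaves hn).trans (Nat.mul_le_mul_left _ Φ.numVarLeaves_le_numVertices)
    · have := Φ.numVertices_pos
      nlinarith
  have hreal {N : ℕ} (hN : n ^ 2 ≤ 1000 * N) : (0.001 : ℝ) * (n : ℝ) ^ 2 ≤ (N : ℝ) := by
    have : (n : ℝ) ^ 2 ≤ 1000 * (N : ℝ) := mod_cast hN
    linarith
  exact ⟨hreal hvertices, fun hn => hreal (hleaves hn)⟩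

-- `n / 10` is the integer part of `0.1 n`, which is `0.1 n` itself if `10` divides `n`.
-- A field of characteristic zero counts as one of large characteristic.
-- The zero polynomial has degree `-∞`, hence the alternative `R = 0` (it matters only if `n < 10`).
theorem theorem5p9 (n : ℕ) (F : Type*) [Field F]
    (hF : ringChar F = 0 ∨ n / 10 < ringChar F)
    (r : ℕ) (hr : r ≤ n / 10)
    (A B : Fin r → MvPolynomial (Fin n) F) (R : MvPolynomial (Fin n) F)
    (hA : ∀ j, MvPolynomial.eval 0 (A j) = 0)
    (hB : ∀ j, MvPolynomial.eval 0 (B j) = 0)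
    (hR : R = 0 ∨ R.totalDegree + 1 ≤ n / 10)
    (Φ : AlgFormula (Fin n) F)
    (hdeg : Φ.formalDegree ≤ n / 10)
    (hΦ : Φ.toPoly = MvPolynomial.esymm (Fin n) F (n / 10) + ∑ j, A j * B j + R) :
    (0.001 : ℝ) * (n : ℝ) ^ 2 ≤ (Φ.numVertices : ℝ) ∧
      (10 ≤ n → (0.001 : ℝ) * (n : ℝ) ^ 2 ≤ (Φ.numVarLeaves : ℝ)) := by
  exact theorem5p9_general n F r hr A B R hA hB hR Φ hdeg hΦ
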